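/- Let \(X\) be a real Banach space with continuous dual \(X^*\) and bidual \(X^{**}\), let \(X\) be identified with its canonical image in \(X^{**}\), and write \(\langle\cdot,\cdot\rangle\) for the duality pairings. For a set-valued operator \(A\colon X\rightrightarrows X^*\) let \(\operatorname{gra}A=\{(x,x^*)\in X\times X^*: x^*\in Ax\}\) and \(\operatorname{ran}A=\bigcup_{x\in X}Ax\). A set \(G\subseteq X\times X^*\) is monotone if \(\langle x-y,x^*-y^*\rangle\ge 0\) for all \((x,x^*),(y,y^*)\in G\), and \((x,x^*)\) is monotonically related to \(G\) if \(\{(x,x^*)\}\cup G\) is monotone. The operator \(A\) is maximally monotone if \(\operatorname{gra}A\) is monotone and is not properly contained in the graph of another monotone operator. Let \(A\colon X\rightrightarrows X^*\) be maximally monotone. Then the following are equivalent. 1. \(A\) is of type (D): for every \((x^{**},x^*)\in X^{**}\times X^*\) with \[\inf_{(a,a^*)\in\operatorname{gra}A}\langle a-x^{**},a^*-x^*\rangle\ge 0\] there is a bounded net \((a_\alpha,a^*_\alpha)_{\alpha\in\Gamma}\) in \(\operatorname{gra}A\) such that \(a_\alpha\to x^{**}\) in the weak* topology of \(X^{**}\)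 and \(a^*_\alpha\to x^*\) in norm. 2. \(A\) is of type (NI): for every \((x^{**},x^*)\in X^{**}\times X^*\), \[\sup_{(a,a^*)\in\operatorname{gra}A}\big(\langle a,x^*\rangle+\langle a^*,x^{**}\rangle-\langle a,a^*\rangle\big)\ge\langle x^{**},x^*\rangle,\] where the supremum may be \(+\infty\). 3. \(A\) is of type (FP): whenever \(U\subseteq X^*\) is open (in the norm topology) and convex with \(U\cap\operatorname{ran}A\ne\varnothing\), \(x^*\in U\), and \((x,x^*)\in X\times X^*\) is monotonically related to \(\operatorname{gra}A\cap(X\times U)\), then \((x,x^*)\in\operatorname{gra}A\). -/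

import Mathlib

open Filter Topology

namespace MonotoneOperator

universe u

variable {X : Type*} [NormedAddCommGroup X] [NormedSpace ℝ X]

/-- The graph of a set-valued operator `A : X ⇉ X*`. -/
def gra (A : X → Set (StrongDual ℝ X)) : Set (X × StrongDual ℝ X) :=
  {p | p.2 ∈ A p.1}

/-- The range of a set-valued operator `A : X ⇉ X*`. -/
def ran (A : X → Set (StrongDual ℝ X)) : Set (StrongDual ℝ X) :=
  ⋃ x, A x

/-- A subset `G` of `X × X*` is monotone if `⟨x - y, x* - y*⟩ ≥ 0` for all
`(x, x*)` and `(y, y*)` in `G`. -/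
def IsMonotoneSet (G : Set (X × StrongDual ℝ X)) : Prop :=
  ∀ p ∈ G, ∀ q ∈ G, 0 ≤ (p.2 - q.2) (p.1 - q.1)

/-- A set-valued operator is monotone if its graph is. -/
def IsMonotone (A : X → Set (StrongDual ℝ X)) : Prop :=
  IsMonotoneSet (gra A)

/-- `A` is maximally monotone if it is monotone and every monotone operator whose graph
contains the graph of `A` is equal to `A`. -/
def IsMaximallyMonotone (A : X → Set (StrongDual ℝ X)) : Prop :=
  IsMonotone A ∧ ∀ B : X → Set (StrongDual ℝ X), IsMonotone B → gra A ⊆ gra B → B = A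

/-- `(x, x*)` is monotonically related to `G` if `{(x, x*)} ∪ G` is monotone. -/
def IsMonotonicallyRelated (p : X × StrongDual ℝ X) (G : Set (X × StrongDual ℝ X)) : Prop :=
  IsMonotoneSet ({p} ∪ G)

/-- Type (D): whenever `inf {⟨a - x**, a* - x*⟩ | (a, a*) ∈ gra A} ≥ 0` (an infimum in the
extended reals), there is a bounded net in `gra A` that converges to `(x**, x*)` in the product
of the weak* topology of `X**` (in which `X` is canonically embedded) and the norm topology
of `X*`. Nets are indexed by nonempty directed preorders in the universe of `X`; this is no
restriction, since for a net over any index set one with the same bound, the same limit and terms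
from the same set exists that is indexed by (finite subsets of `X*`) `× ℕ`. -/
def IsTypeD {X : Type u} [NormedAddCommGroup X] [NormedSpace ℝ X]
    (A : X → Set (StrongDual ℝ X)) : Prop :=
  ∀ (x'' : StrongDual ℝ (StrongDual ℝ X)) (x' : StrongDual ℝ X),
    (0 : EReal) ≤ ⨅ p ∈ gra A,
      (((NormedSpace.inclusionInDoubleDual ℝ X p.1 - x'') (p.2 - x') : ℝ) : EReal) →
    ∃ (Γ : Type u) (_ : Preorder Γ) (_ : IsDirectedOrder Γ) (_ : Nonempty Γ)
      (a : Γ → X) (a' : Γ → StrongDual ℝ X),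
      (∀ i, (a i, a' i) ∈ gra A) ∧
      (∃ M : ℝ, ∀ i, ‖a i‖ ≤ M ∧ ‖a' i‖ ≤ M) ∧
      Tendsto (fun i => StrongDual.toWeakDual (NormedSpace.inclusionInDoubleDual ℝ X (a i)))
        atTop (𝓝 (StrongDual.toWeakDual x'')) ∧
      Tendsto a' atTop (𝓝 x')

/-- Type (NI), "negative infimum"; the supremum is taken in the extended reals. -/
def IsTypeNI (A : X → Set (StrongDual ℝ X)) : Prop :=
  ∀ (x'' : StrongDual ℝ (StrongDual ℝ X)) (x' : StrongDual ℝ X),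
    ((x'' x' : ℝ) : EReal) ≤ ⨆ p ∈ gra A, ((x' p.1 + x'' p.2 - p.2 p.1 : ℝ) : EReal)

/-- Type (FP), "Fitzpatrick-Phelps". -/
def IsTypeFP (A : X → Set (StrongDual ℝ X)) : Prop :=
  ∀ U : Set (StrongDual ℝ X), IsOpen U → Convex ℝ U → (U ∩ ran A).Nonempty →
    ∀ (x : X) (x' : StrongDual ℝ X), x' ∈ U →
      IsMonotonicallyRelated (x, x') (gra A ∩ (Set.univ ×ˢ U)) → (x, x') ∈ gra A

end MonotoneOperator

/-! Let h be the convex function on X × X* whose epigraph is generated by `pairingHull A`.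
Maximality gives h ≥ pairing (`IsMaximallyMonotone.pairing_le_of_mem_pairingHull`), and (NI) says
exactly that the conjugate of h majorizes the pairing on X* × X**. If (NI) fails at (x**, x*), then
⟨a - x**, a* - x*⟩ is bounded below by some γ > 0 on the graph. A net as in (D) would drive it to 0.
Under (FP), a point x of X that agrees with x** in one well-chosen direction is forced into the
graph together with x*, where the expression vanishes. Conversely, Fenchel duality applied to h plus
half the squared norms on X and X* gives a Brøndsted–Rockafellar property (`exists_mem_gra_near`): a
hull point with small excess over the pairing is close to the graph. For (D), the relation to the
graph turns (x**, x*) into a subgradient of the conjugate; a separation argument with Helly's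
theorem then yields bounded hull points near (x**, x*) with small excess. For (FP), half the squared
norm on X* is restricted to a thickened segment W inside U and its counterpart on X is replaced by
`negConj W`. The approximate minimizers then stay over U, where the monotone relation is available
and forces them towards the given point. -/

namespace MonotoneOperator

/-! ### Basic facts, and the implications (D) ⟹ (NI) and (FP) ⟹ (NI) -/

section

variable {X : Type*} [NormedAddCommGroup X] [NormedSpace ℝ X]

/-- `A` is of type (NI) iff its Fitzpatrick function on the bidual majorizes the pairing. -/
theorem isTypeNI_iff {A : X → Set (StrongDual ℝ X)} :
    IsTypeNI A ↔ ∀ (x'' : StrongDual ℝ (StrongDual ℝ X)) (x' : StrongDual ℝ X) (c : ℝ),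
      (∀ p ∈ gra A, x' p.1 + x'' p.2 - p.2 p.1 ≤ c) → x'' x' ≤ c := by
  constructor
  · intro h x'' x' c hc
    have h1 : (⨆ p ∈ gra A, ((x' p.1 + x'' p.2 - p.2 p.1 : ℝ) : EReal)) ≤ (c : EReal) :=
      iSup₂_le fun p hp => EReal.coe_le_coe_iff.2 (hc p hp)
    exact EReal.coe_le_coe_iff.1 ((h x'' x').trans h1)
  · intro h x'' x'
    by_contra! hlt
    obtain ⟨c, hc1, hc2⟩ := EReal.lt_iff_exists_real_btwn.1 hlt
    have := h x'' x' c fun p hp => EReal.coe_le_coe_iff.1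
      ((le_iSup₂ (f := fun p (_ : p ∈ gra A) =>
        ((x' p.1 + x'' p.2 - p.2 p.1 : ℝ) : EReal)) p hp).trans hc1.le)
    exact absurd (EReal.coe_lt_coe_iff.1 hc2) (not_lt.2 this)

theorem IsMaximallyMonotone.mem_gra {A : X → Set (StrongDual ℝ X)} (hA : IsMaximallyMonotone A)
    {x : X} {x' : StrongDual ℝ X} (h : ∀ p ∈ gra A, 0 ≤ (p.2 - x') (p.1 - x)) :
    (x, x') ∈ gra A := by
  let B : X → Set (StrongDual ℝ X) := fun y => {y' | y' ∈ A y ∨ (y = x ∧ y' = x')}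
  have hB : IsMonotone B := by
    rintro ⟨a, a'⟩ (ha | ⟨ha, ha'⟩) ⟨b, b'⟩ (hb | ⟨hb, hb'⟩)
    · exact hA.1 _ ha _ hb
    · dsimp only at hb hb' ⊢
      subst hb hb'
      exact h _ ha
    · dsimp only at ha ha' ⊢
      subst ha ha'
      have := h _ hb
      dsimp only at this
      rw [← neg_sub b' a', ← neg_sub b a]
      rwa [map_neg, neg_apply, neg_neg]
    · dsimp only at ha ha' hb hb' ⊢
      subst ha ha' hb hb'
      simp
  have := hA.2 B hB fun p hp => Or.inl hp
  change x' ∈ A x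
  rw [← this]
  exact Or.inr ⟨rfl, rfl⟩

theorem isMonotonicallyRelated_of_forall {G : Set (X × StrongDual ℝ X)} (hG : IsMonotoneSet G)
    {p : X × StrongDual ℝ X} (h : ∀ q ∈ G, 0 ≤ (q.2 - p.2) (q.1 - p.1)) :
    IsMonotonicallyRelated p G := by
  rintro a (ha | ha) b (hb | hb)
  · rw [Set.mem_singleton_iff.1 ha, Set.mem_singleton_iff.1 hb]
    simp
  · rw [Set.mem_singleton_iff.1 ha, ← neg_sub b.2, ← neg_sub b.1]
    simpa only [map_neg, neg_apply, neg_neg] using h b hb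
  · rw [Set.mem_singleton_iff.1 hb]
    exact h a ha
  · exact hG a ha b hb

theorem IsMaximallyMonotone.gra_nonempty {A : X → Set (StrongDual ℝ X)}
    (hA : IsMaximallyMonotone A) : (gra A).Nonempty := by
  by_contra h
  rw [Set.not_nonempty_iff_eq_empty] at h
  have : ((0 : X), (0 : StrongDual ℝ X)) ∈ gra A := hA.mem_gra (by simp [h])
  simp [h] at this

theorem IsMaximallyMonotone.isClosed_gra {A : X → Set (StrongDual ℝ X)}
    (hA : IsMaximallyMonotone A) : IsClosed (gra A) := by
  have : gra A = ⋂ p ∈ gra A, {q : X × StrongDual ℝ X | 0 ≤ (p.2 - q.2) (p.1 - q.1)} := by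
    ext q
    simp only [Set.mem_iInter, Set.mem_ofPred_eq]
    exact ⟨fun hq p hp => hA.1 p hp q hq, fun h => hA.mem_gra h⟩
  rw [this]
  refine isClosed_biInter fun p _ => isClosed_le continuous_const ?_
  exact (continuous_const.sub continuous_snd).clm_apply (continuous_const.sub continuous_fst)

/-- The gap left by a failure of (NI) cannot survive: the first factor of the pairing stays bounded
along the net while the second tends to 0 in norm. -/
theorem IsTypeD.isTypeNI {X : Type*} [NormedAddCommGroup X] [NormedSpace ℝ X]
    {A : X → Set (StrongDual ℝ X)} (hD : IsTypeD A) : IsTypeNI A := by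
  rw [isTypeNI_iff]
  intro x'' x' c hc
  by_contra! hlt
  have key : ∀ p ∈ gra A, x'' x' - c ≤
      (NormedSpace.inclusionInDoubleDual ℝ X p.1 - x'') (p.2 - x') := by
    intro p hp
    have := hc p hp
    simp only [sub_apply, map_sub, NormedSpace.dual_def]
    linarith
  obtain ⟨Γ, _, _, _, a, a', hmem, ⟨M, hM⟩, ha, ha'⟩ := hD x'' x'
    (le_iInf₂ fun p hp => EReal.coe_nonneg.2 (by linarith [key p hp]))
  have hbound : ∀ i, x'' x' - c ≤ (M + ‖x''‖) * ‖a' i - x'‖ := by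
    intro i
    have h1 := key _ (hmem i)
    have h2 := (a' i - x').le_opNorm (a i)
    have h3 := x''.le_opNorm (a' i - x')
    have h4 := mul_le_mul_of_nonneg_left (hM i).1 (norm_nonneg (a' i - x'))
    rw [Real.norm_eq_abs] at h2 h3
    rw [sub_apply, NormedSpace.dual_def] at h1
    linarith [le_abs_self ((a' i - x') (a i)), neg_abs_le (x'' (a' i - x'))]
  have hlim : Tendsto (fun i => (M + ‖x''‖) * ‖a' i - x'‖) atTop (𝓝 0) := by
    have := (tendsto_iff_norm_sub_tendsto_zero.1 ha').const_mul (M + ‖x''‖)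
    rwa [mul_zero] at this
  linarith [ge_of_tendsto' hlim hbound]

theorem IsTypeFP.isTypeNI {A : X → Set (StrongDual ℝ X)} (hA : IsMaximallyMonotone A)
    (hFP : IsTypeFP A) : IsTypeNI A := by
  rw [isTypeNI_iff]
  intro x'' x' c hc
  by_contra! hlt
  have key : ∀ p ∈ gra A, x'' x' - c ≤
      (NormedSpace.inclusionInDoubleDual ℝ X p.1 - x'') (p.2 - x') := by
    intro p hp
    have := hc p hp
    simp only [sub_apply, map_sub, NormedSpace.dual_def]
    linarith
  obtain ⟨⟨b, b'⟩, hb⟩ := hA.gra_nonempty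
  have hb' : b' - x' ≠ 0 := by
    intro h
    have := key _ hb
    simp only [h, map_zero] at this
    linarith
  -- Since x and x** agree on b' - x', their difference is constant along the segment [x', b'], and
  -- small increments are all that matter near it.
  obtain ⟨x, hx⟩ : ∃ x, (b' - x') x = x'' (b' - x') := by
    obtain ⟨z, hz⟩ : ∃ z, (b' - x') z ≠ 0 := by
      by_contra! h
      exact hb' (ContinuousLinearMap.ext h)
    refine ⟨(x'' (b' - x') / (b' - x') z) • z, ?_⟩
    rw [map_smul, smul_eq_mul, div_mul_cancel₀ _ hz]
  set N := ‖x‖ + ‖x''‖ with hN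
  have hN0 : 0 ≤ N := by positivity
  -- This radius makes N * ρ at most the gap; the summand 1 avoids division by zero.
  set ρ := (x'' x' - c) / (N + 1) with hρdef
  have hρ : 0 < ρ := div_pos (by linarith) (by linarith)
  have hsub := Metric.self_subset_thickening hρ (segment ℝ x' b')
  have hmem : (x, x') ∈ gra A := by
    refine hFP (Metric.thickening ρ (segment ℝ x' b')) Metric.isOpen_thickening
      ((convex_segment _ _).thickening _)
      ⟨b', hsub (right_mem_segment ℝ _ _), Set.mem_iUnion.2 ⟨b, hb⟩⟩ x x'
      (hsub (left_mem_segment ℝ _ _)) (isMonotonicallyRelated_of_forall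
        (fun p hp q hq => hA.1 p hp.1 q hq.1) ?_)
    rintro ⟨a, a'⟩ ⟨ha, -, haU⟩
    obtain ⟨w, hw, hdist⟩ := Metric.mem_thickening_iff.1 haU
    rw [segment_eq_image'] at hw
    obtain ⟨l, -, rfl⟩ := hw
    rw [dist_eq_norm] at hdist
    dsimp only at hdist ⊢
    have h1 := key _ ha
    have h2 : (NormedSpace.inclusionInDoubleDual ℝ X x - x'') (a' - x') =
        (NormedSpace.inclusionInDoubleDual ℝ X x - x'') (a' - (x' + l • (b' - x'))) := by
      have : (NormedSpace.inclusionInDoubleDual ℝ X x - x'') (b' - x') = 0 := by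
        rw [sub_apply, NormedSpace.dual_def, hx, sub_self]
      rw [← sub_sub, map_sub _ (a' - x'), map_smul, this, smul_zero, sub_zero]
    have h3 : (NormedSpace.inclusionInDoubleDual ℝ X x - x'') (a' - x') ≤
        N * ‖a' - (x' + l • (b' - x'))‖ := by
      have h5 := (a' - (x' + l • (b' - x'))).le_opNorm x
      have h6 := x''.le_opNorm (a' - (x' + l • (b' - x')))
      rw [Real.norm_eq_abs] at h5 h6
      rw [h2, hN, sub_apply, NormedSpace.dual_def]
      linarith [le_abs_self ((a' - (x' + l • (b' - x'))) x),
        neg_abs_le (x'' (a' - (x' + l • (b' - x'))))]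
    have h4 : N * ‖a' - (x' + l • (b' - x'))‖ ≤ x'' x' - c := by
      refine (mul_le_mul_of_nonneg_left hdist.le hN0).trans ?_
      rw [hρdef, mul_div_assoc', div_le_iff₀ (by linarith)]
      nlinarith
    simp only [sub_apply, map_sub, NormedSpace.dual_def] at h1 h3 ⊢
    linarith
  have := key _ hmem
  simp only [sub_self, map_zero] at this
  linarith

end

/-! ### The convex function generated by the pairing, and Fenchel duality -/

section

variable {X : Type*} [NormedAddCommGroup X] [NormedSpace ℝ X]

/-- The convex hull of the graph of the duality pairing restricted to `gra A`. -/
def pairingHull (A : X → Set (StrongDual ℝ X)) : Set (X × StrongDual ℝ X × ℝ) :=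
  convexHull ℝ ((fun p => (p.1, p.2, p.2 p.1)) '' gra A)

theorem convex_pairingHull (A : X → Set (StrongDual ℝ X)) : Convex ℝ (pairingHull A) :=
  convex_convexHull ℝ _

theorem mem_pairingHull {A : X → Set (StrongDual ℝ X)} {p : X × StrongDual ℝ X}
    (hp : p ∈ gra A) : (p.1, p.2, p.2 p.1) ∈ pairingHull A :=
  subset_convexHull ℝ _ ⟨p, hp, rfl⟩

/-- Affine inequalities on the graph extend to its hull. -/
theorem pairingHull_le {A : X → Set (StrongDual ℝ X)} {x' : StrongDual ℝ X}
    {x'' : StrongDual ℝ (StrongDual ℝ X)} {s c : ℝ}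
    (h : ∀ p ∈ gra A, x' p.1 + x'' p.2 - s * p.2 p.1 ≤ c) :
    ∀ p ∈ pairingHull A, x' p.1 + x'' p.2.1 - s * p.2.2 ≤ c := by
  have hconv : Convex ℝ {p : X × StrongDual ℝ X × ℝ | x' p.1 + x'' p.2.1 - s * p.2.2 ≤ c} := by
    intro p hp q hq a b ha hb hab
    simp only [Set.mem_ofPred_eq, Prod.fst_add, Prod.snd_add, Prod.smul_fst, Prod.smul_snd,
      map_add, map_smul, smul_eq_mul] at hp hq ⊢
    have := add_le_add (mul_le_mul_of_nonneg_left hp ha) (mul_le_mul_of_nonneg_left hq hb)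
    rw [← add_mul, hab, one_mul] at this
    linarith
  refine fun p hp => convexHull_min ?_ hconv hp
  rintro _ ⟨p, hp, rfl⟩
  exact h p hp

/-- This places the Fitzpatrick function below the hull: for fixed b the bound is affine, and on the
graph it is monotonicity. -/
theorem IsMonotone.pairingHull_le {A : X → Set (StrongDual ℝ X)} (hA : IsMonotone A)
    {b : X × StrongDual ℝ X} (hb : b ∈ gra A) {p : X × StrongDual ℝ X × ℝ}
    (hp : p ∈ pairingHull A) : p.2.1 b.1 + b.2 p.1 - b.2 b.1 ≤ p.2.2 := by
  have := MonotoneOperator.pairingHull_le (A := A) (x' := b.2)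
    (x'' := NormedSpace.inclusionInDoubleDual ℝ X b.1) (s := 1) (c := b.2 b.1) (fun q hq => by
      have := hA b hb q hq
      simp only [sub_apply, map_sub] at this
      rw [NormedSpace.dual_def]
      linarith) p hp
  rw [NormedSpace.dual_def] at this
  linarith

/-- A violation would make the point strictly related to every graph element. Maximality puts it in
the graph, and it is then strictly related to itself, which is absurd. -/
theorem IsMaximallyMonotone.pairing_le_of_mem_pairingHull {A : X → Set (StrongDual ℝ X)}
    (hA : IsMaximallyMonotone A) {p : X × StrongDual ℝ X × ℝ} (hp : p ∈ pairingHull A) :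
    p.2.1 p.1 ≤ p.2.2 := by
  by_contra! hlt
  have key : ∀ b ∈ gra A, p.2.1 b.1 + b.2 p.1 - b.2 b.1 < p.2.1 p.1 := fun b hb =>
    (hA.1.pairingHull_le hb hp).trans_lt hlt
  have hmem : (p.1, p.2.1) ∈ gra A := hA.mem_gra fun b hb => by
    have := key b hb
    simp only [sub_apply, map_sub]
    linarith
  have := key _ hmem
  simp at this

/-- The conjugate of the convex function generated by `C` majorizes the pairing. -/
def ConjMajorizesPairing (C : Set (X × StrongDual ℝ X × ℝ)) : Prop :=
  ∀ (y' : StrongDual ℝ X) (y'' : StrongDual ℝ (StrongDual ℝ X)) (c : ℝ),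
    (∀ p ∈ C, y' p.1 + y'' p.2.1 - p.2.2 ≤ c) → y'' y' ≤ c

theorem IsTypeNI.conjMajorizesPairing {A : X → Set (StrongDual ℝ X)} (hA : IsTypeNI A) :
    ConjMajorizesPairing (pairingHull A) := fun y' y'' c h =>
  isTypeNI_iff.1 hA y'' y' c fun _ hp => h _ (mem_pairingHull hp)

/-- Separation of a convex set from an open convex set that is unbounded below in the last
variable, with coordinates for the separating functional. -/
theorem exists_separation {C O : Set (X × StrongDual ℝ X × ℝ)} (hC : Convex ℝ C)
    (hO : Convex ℝ O) (hOo : IsOpen O) (hne : O.Nonempty)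
    (hdown : ∀ p ∈ O, ∀ t ≤ p.2.2, (p.1, p.2.1, t) ∈ O) (hd : Disjoint O C) :
    ∃ (y' : StrongDual ℝ X) (y'' : StrongDual ℝ (StrongDual ℝ X)) (s c : ℝ), 0 ≤ s ∧
      (∀ p ∈ O, y' p.1 + y'' p.2.1 + s * p.2.2 < c) ∧
      ∀ p ∈ C, c ≤ y' p.1 + y'' p.2.1 + s * p.2.2 := by
  obtain ⟨φ, c, h1, h2⟩ := geometric_hahn_banach_open hO hOo hC hd
  let y' : StrongDual ℝ X := φ.comp (ContinuousLinearMap.inl ℝ X (StrongDual ℝ X × ℝ))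
  let y'' : StrongDual ℝ (StrongDual ℝ X) :=
    (φ.comp (ContinuousLinearMap.inr ℝ X (StrongDual ℝ X × ℝ))).comp
      (ContinuousLinearMap.inl ℝ (StrongDual ℝ X) ℝ)
  let s := φ (0, 0, 1)
  have hφ : ∀ p, φ p = y' p.1 + y'' p.2.1 + s * p.2.2 := by
    rintro ⟨x, w, t⟩
    have : (x, w, t) = (x, (0 : StrongDual ℝ X × ℝ)) + ((0 : X), (w, (0 : ℝ)))
        + t • ((0 : X), ((0 : StrongDual ℝ X), (1 : ℝ))) := by simp
    rw [this, map_add, map_add, map_smul]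
    simp [y', y'', s, mul_comm]
  refine ⟨y', y'', s, c, ?_, fun p hp => hφ p ▸ h1 p hp, fun p hp => hφ p ▸ h2 p hp⟩
  by_contra! hs
  obtain ⟨p, hp⟩ := hne
  have h3 := h1 _ (hdown p hp (min p.2.2 ((c - y' p.1 - y'' p.2.1) / s)) (min_le_left _ _))
  rw [hφ] at h3
  dsimp only at h3
  have h4 := mul_le_mul_of_nonpos_left
    (min_le_right p.2.2 ((c - y' p.1 - y'' p.2.1) / s)) hs.le
  rw [mul_div_cancel₀ _ hs.ne] at h4
  linarith

/-- Fenchel duality: if the conjugate of the convex function generated by `C` majorizes the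
pairing, and the conjugate of `f + g` majorizes its opposite, then the infimum of the sum of
the two functions is nonpositive. -/
theorem exists_add_lt_of_conjMajorizesPairing {C : Set (X × StrongDual ℝ X × ℝ)}
    (hC : Convex ℝ C) (hNI : ConjMajorizesPairing C) {W : Set (StrongDual ℝ X)}
    {f : X → ℝ} {g : StrongDual ℝ X → ℝ} (hW : IsOpen W) (hf : ConvexOn ℝ Set.univ f)
    (hfc : Continuous f) (hg : ConvexOn ℝ W g) (hgc : Continuous g)
    (hCW : ∃ p ∈ C, p.2.1 ∈ W)
    (hconj : ∀ (y' : StrongDual ℝ X) (y'' : StrongDual ℝ (StrongDual ℝ X)) (c : ℝ),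
      (∀ z, ∀ w ∈ W, y' z + y'' w - f z - g w ≤ c) → -y'' y' ≤ c) {δ : ℝ} (hδ : 0 < δ) :
    ∃ p ∈ C, p.2.1 ∈ W ∧ p.2.2 + f p.1 + g p.2.1 < δ := by
  by_contra! hcon
  -- The strict hypograph of δ - f - g over W; it misses C exactly when the claim fails.
  let O : Set (X × StrongDual ℝ X × ℝ) := {p | p.2.1 ∈ W ∧ p.2.2 + f p.1 + g p.2.1 < δ}
  obtain ⟨e, he, heW⟩ := hCW
  have hO : Convex ℝ O := by
    rintro p ⟨hp, hp'⟩ q ⟨hq, hq'⟩ a b ha hb hab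
    refine ⟨hg.1 hp hq ha hb hab, ?_⟩
    have h1 := hf.2 (Set.mem_univ p.1) (Set.mem_univ q.1) ha hb hab
    have h2 := hg.2 hp hq ha hb hab
    simp only [Prod.fst_add, Prod.snd_add, Prod.smul_fst, Prod.smul_snd, smul_eq_mul] at h1 h2 ⊢
    have h3 : a * (p.2.2 + f p.1 + g p.2.1) + b * (q.2.2 + f q.1 + g q.2.1) < δ := by
      rcases ha.eq_or_lt with rfl | ha
      · rw [zero_add] at hab
        subst hab
        linarith
      · have := mul_lt_mul_of_pos_left hp' ha
        have := mul_le_mul_of_nonneg_left hq'.le hb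
        have : a * δ + b * δ = δ := by rw [← add_mul, hab, one_mul]
        linarith
    linarith
  have hOo : IsOpen O := by
    have : IsOpen {p : X × StrongDual ℝ X × ℝ | p.2.2 + f p.1 + g p.2.1 < δ} :=
      isOpen_lt (((continuous_snd.comp continuous_snd).add (hfc.comp continuous_fst)).add
        (hgc.comp (continuous_fst.comp continuous_snd))) continuous_const
    exact (hW.preimage (continuous_fst.comp continuous_snd)).inter this
  have hmemO : ∀ (z : X), ∀ w ∈ W, ∀ t < δ - f z - g w, (z, w, t) ∈ O := fun z w hw t ht =>
    ⟨hw, by dsimp only; linarith⟩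
  obtain ⟨y', y'', s, c, hs, h1, h2⟩ := exists_separation hC hO hOo
    ⟨_, hmemO 0 _ heW (δ - f 0 - g e.2.1 - 1) (by linarith)⟩
    (fun p hp t ht => ⟨hp.1, by have := hp.2; dsimp only; linarith⟩)
    (Set.disjoint_left.2 fun p hp hpC => (hcon p hpC hp.1).not_gt hp.2)
  -- A vertical hyperplane is impossible, since the line over e meets both sets. Otherwise, after
  -- division by s, the two conjugate bounds add up to 0 ≤ -δ.
  rcases hs.eq_or_lt with rfl | hs
  · have h3 := h1 _ (hmemO e.1 _ heW (δ - f e.1 - g e.2.1 - 1) (by linarith))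
    have h4 := h2 _ he
    simp only [zero_mul, add_zero] at h3 h4
    linarith
  · have h3 : -((s⁻¹ • y'') (s⁻¹ • y')) ≤ c / s - δ := by
      refine hconj _ _ _ fun z w hw => le_of_forall_pos_le_add fun η hη => ?_
      have := h1 _ (hmemO z w hw (δ - f z - g w - η) (by linarith))
      dsimp only at this
      have := (lt_div_iff₀' hs).2 (show s * (s⁻¹ * y' z + s⁻¹ * y'' w + (δ - f z - g w - η)) < c by
        rw [mul_add, mul_add, mul_inv_cancel_left₀ hs.ne', mul_inv_cancel_left₀ hs.ne']
        exact this)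
      simp only [smul_apply, smul_eq_mul]
      linarith
    have h4 : (-(s⁻¹ • y'')) (-(s⁻¹ • y')) ≤ -(c / s) := by
      refine hNI _ _ _ fun p hp => ?_
      have := (div_le_iff₀' hs).2 (show c ≤ s * (s⁻¹ * y' p.1 + s⁻¹ * y'' p.2.1 + p.2.2) by
        rw [mul_add, mul_add, mul_inv_cancel_left₀ hs.ne', mul_inv_cancel_left₀ hs.ne']
        exact h2 p hp)
      simp only [neg_apply, smul_apply, smul_eq_mul]
      linarith
    rw [neg_apply, map_neg, neg_neg] at h4
    linarith

/-- The version of `exists_add_lt_of_conjMajorizesPairing` centred at `(x₀, w₀)`. -/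
theorem exists_add_lt_of_conjMajorizesPairing_center {C : Set (X × StrongDual ℝ X × ℝ)}
    (hC : Convex ℝ C) (hNI : ConjMajorizesPairing C) {W : Set (StrongDual ℝ X)}
    {f : X → ℝ} {g : StrongDual ℝ X → ℝ} (hW : IsOpen W) (hf : ConvexOn ℝ Set.univ f)
    (hfc : Continuous f) (hg : ConvexOn ℝ W g) (hgc : Continuous g)
    (x₀ : X) (w₀ : StrongDual ℝ X) (hCW : ∃ p ∈ C, p.2.1 - w₀ ∈ W)
    (hconj : ∀ (y' : StrongDual ℝ X) (y'' : StrongDual ℝ (StrongDual ℝ X)) (c : ℝ),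
      (∀ z, ∀ w ∈ W, y' z + y'' w - f z - g w ≤ c) → -y'' y' ≤ c) {δ : ℝ} (hδ : 0 < δ) :
    ∃ p ∈ C, p.2.1 - w₀ ∈ W ∧
      p.2.2 - w₀ p.1 - p.2.1 x₀ + w₀ x₀ + f (p.1 - x₀) + g (p.2.1 - w₀) < δ := by
  -- This translation preserves the excess of the last coordinate over the pairing, hence convexity
  -- and the conjugate bound.
  let Φ : X × StrongDual ℝ X × ℝ → X × StrongDual ℝ X × ℝ := fun p =>
    (p.1 - x₀, p.2.1 - w₀, p.2.2 - w₀ p.1 - p.2.1 x₀ + w₀ x₀)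
  have hC' : Convex ℝ (Φ '' C) := by
    rintro _ ⟨p, hp, rfl⟩ _ ⟨q, hq, rfl⟩ a b ha hb hab
    refine ⟨a • p + b • q, hC hp hq ha hb hab, ?_⟩
    have hb' : b = 1 - a := by linarith
    subst hb'
    refine Prod.ext ?_ (Prod.ext ?_ ?_)
    · simp only [Φ, Prod.fst_add, Prod.smul_fst]
      module
    · simp only [Φ, Prod.fst_add, Prod.smul_fst, Prod.snd_add, Prod.smul_snd]
      module
    · simp only [Φ, Prod.fst_add, Prod.smul_fst, Prod.snd_add, Prod.smul_snd, map_add, map_smul,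
        add_apply, smul_apply, smul_eq_mul]
      ring
  have hNI' : ConjMajorizesPairing (Φ '' C) := by
    intro y' y'' c h
    have := hNI (y' + w₀) (y'' + NormedSpace.inclusionInDoubleDual ℝ X x₀)
      (c + y' x₀ + y'' w₀ + w₀ x₀) fun p hp => by
        have := h _ ⟨p, hp, rfl⟩
        simp only [Φ, map_sub] at this
        simp only [add_apply, NormedSpace.dual_def]
        linarith
    simp only [add_apply, NormedSpace.dual_def, map_add] at this
    linarith
  obtain ⟨p, hp, hpW⟩ := hCW
  obtain ⟨_, ⟨q, hq, rfl⟩, hqW, hlt⟩ := exists_add_lt_of_conjMajorizesPairing hC' hNI' hW hf hfc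
    hg hgc ⟨_, ⟨p, hp, rfl⟩, hpW⟩ hconj hδ
  exact ⟨q, hq, hqW, hlt⟩

end

/-! ### The Brøndsted–Rockafellar property -/

section

variable {X : Type*} [NormedAddCommGroup X] [NormedSpace ℝ X]

theorem half_sq_norm_le {E : Type*} [NormedAddCommGroup E] [NormedSpace ℝ E] {φ : StrongDual ℝ E}
    {k : ℝ} (h : ∀ z, φ z - ‖z‖ ^ 2 / 2 ≤ k) : ‖φ‖ ^ 2 / 2 ≤ k := by
  have hk : 0 ≤ k := by simpa using h 0
  have hle : ‖φ‖ ≤ √(2 * k) := by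
    refine φ.opNorm_le_bound (Real.sqrt_nonneg _) fun z => ?_
    rcases eq_or_ne z 0 with rfl | hz
    · simp
    have hz' : 0 < ‖z‖ ^ 2 := by positivity
    -- This multiple maximizes the left side of `h` on the line through z.
    have h1 := h ((φ z / ‖z‖ ^ 2) • z)
    rw [map_smul, smul_eq_mul, norm_smul, mul_pow, Real.norm_eq_abs, sq_abs] at h1
    have h2 : (φ z) ^ 2 ≤ 2 * k * ‖z‖ ^ 2 := by
      have : φ z / ‖z‖ ^ 2 * φ z - (φ z / ‖z‖ ^ 2) ^ 2 * ‖z‖ ^ 2 / 2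
          = (φ z) ^ 2 / ‖z‖ ^ 2 / 2 := by
        field_simp
        ring
      rw [this, div_div, div_le_iff₀ (by positivity)] at h1
      linarith
    rw [Real.norm_eq_abs]
    refine abs_le_of_sq_le_sq ?_ (by positivity)
    rw [mul_pow, Real.sq_sqrt (by linarith)]
    exact h2
  have := pow_le_pow_left₀ (norm_nonneg φ) hle 2
  rw [Real.sq_sqrt (by linarith)] at this
  linarith

theorem convexOn_half_sq_norm {E : Type*} [NormedAddCommGroup E] [NormedSpace ℝ E] :
    ConvexOn ℝ Set.univ fun z : E => ‖z‖ ^ 2 / 2 := by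
  have := ((convexOn_norm (convex_univ (𝕜 := ℝ) (E := E))).pow (fun _ _ => norm_nonneg _) 2).smul
    (show (0 : ℝ) ≤ 1 / 2 by norm_num)
  refine this.congr fun z _ => ?_
  simp only [Pi.pow_apply, smul_eq_mul]
  ring

theorem continuous_half_sq_norm {E : Type*} [NormedAddCommGroup E] :
    Continuous fun z : E => ‖z‖ ^ 2 / 2 := by fun_prop

theorem abs_pairing_le (w : StrongDual ℝ X) (x : X) : |w x| ≤ ‖w‖ * ‖x‖ := w.le_opNorm x

/-- One step of the Brøndsted–Rockafellar iteration. -/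
theorem exists_mem_pairingHull_near {A : X → Set (StrongDual ℝ X)} (hA : IsMaximallyMonotone A)
    (hNI : IsTypeNI A) {p : X × StrongDual ℝ X × ℝ} (hp : p ∈ pairingHull A) {ε δ : ℝ}
    (hε : p.2.2 - p.2.1 p.1 < ε) (hδ : 0 < δ) :
    ∃ q ∈ pairingHull A, q.2.2 - q.2.1 q.1 < δ ∧
      ‖q.1 - p.1‖ ^ 2 + ‖q.2.1 - p.2.1‖ ^ 2 ≤ 4 * (ε + δ) := by
  obtain ⟨q, hq, -, hlt⟩ := exists_add_lt_of_conjMajorizesPairing_center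
    (convex_pairingHull A) hNI.conjMajorizesPairing isOpen_univ convexOn_half_sq_norm
    continuous_half_sq_norm convexOn_half_sq_norm continuous_half_sq_norm p.1 p.2.1
    ⟨p, hp, Set.mem_univ _⟩ (fun y' y'' c h => by
      have h1 : ‖y'‖ ^ 2 / 2 ≤ c + y'' y' + ‖y'‖ ^ 2 / 2 := half_sq_norm_le fun z => by
        have := h z (-y') (Set.mem_univ _)
        rw [map_neg, norm_neg] at this
        linarith
      linarith) hδ
  have hd := abs_pairing_le (q.2.1 - p.2.1) (q.1 - p.1)
  have hd1 := neg_abs_le ((q.2.1 - p.2.1) (q.1 - p.1))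
  -- At the midpoint of p and q, the majorization bounds the pairing of the differences below by -2
  -- times the sum of the two excesses, which controls the distances.
  have hm := hA.pairing_le_of_mem_pairingHull
    (convex_pairingHull A hp hq (a := 1 / 2) (b := 1 / 2) (by norm_num) (by norm_num)
      (by norm_num))
  simp only [Prod.fst_add, Prod.smul_fst, Prod.snd_add, Prod.smul_snd, map_add, map_smul,
    add_apply, smul_apply, smul_eq_mul, sub_apply, map_sub] at hm hd1
  simp only [sub_apply, map_sub] at hd
  have hsq := sq_nonneg (‖q.2.1 - p.2.1‖ - ‖q.1 - p.1‖)
  refine ⟨q, hq, ?_, ?_⟩ <;> nlinarith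

/-- A Brøndsted–Rockafellar property of maximally monotone operators of type (NI). -/
theorem exists_mem_gra_near [CompleteSpace X] {A : X → Set (StrongDual ℝ X)}
    (hA : IsMaximallyMonotone A) (hNI : IsTypeNI A) {p : X × StrongDual ℝ X × ℝ}
    (hp : p ∈ pairingHull A) {ε : ℝ} (hε : 0 < ε) (hpε : p.2.2 - p.2.1 p.1 < ε ^ 2) :
    ∃ q ∈ gra A, ‖q.1 - p.1‖ ≤ 6 * ε ∧ ‖q.2 - p.2.1‖ ≤ 6 * ε := by
  -- With ε_n = ε / 2 ^ n, a step has squared length at most 4(ε_n² + ε_n² / 4) ≤ (3ε_n)², so the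
  -- total displacement is at most 6ε. Only the X and X* components are needed in the limit: the
  -- excess tends to 0, so the limit is related to the graph.
  let S : ℕ → Type _ := fun n =>
    {q : X × StrongDual ℝ X × ℝ // q ∈ pairingHull A ∧ q.2.2 - q.2.1 q.1 < (ε / 2 ^ n) ^ 2}
  have hstep : ∀ n (q : S n), ∃ r : S (n + 1), ‖q.1.1 - r.1.1‖ ≤ 6 * ε / 2 / 2 ^ n ∧
      ‖q.1.2.1 - r.1.2.1‖ ≤ 6 * ε / 2 / 2 ^ n := by
    rintro n ⟨q, hq, hqε⟩
    obtain ⟨r, hr, hrε, hN⟩ := exists_mem_pairingHull_near hA hNI hq hqε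
      (show 0 < (ε / 2 ^ (n + 1)) ^ 2 by positivity)
    refine ⟨⟨r, hr, hrε⟩, ?_⟩
    have h1 : 6 * ε / 2 / 2 ^ n = 3 * (ε / 2 ^ n) := by ring
    have h2 : (ε / 2 ^ (n + 1)) ^ 2 = (ε / 2 ^ n) ^ 2 / 4 := by
      rw [pow_succ]
      ring
    have h3 : 0 < ε / 2 ^ n := by positivity
    rw [h1, norm_sub_rev, norm_sub_rev q.2.1]
    rw [h2] at hN
    constructor <;>
    · refine abs_le_of_sq_le_sq' ?_ (by positivity) |>.2
      nlinarith [sq_nonneg ‖r.1 - q.1‖, sq_nonneg ‖r.2.1 - q.2.1‖]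
  choose F hF1 hF2 using hstep
  let s : ∀ n, S n := fun n => Nat.rec ⟨p, hp, by simpa using hpε⟩ F n
  have hs1 : ∀ n, dist (s n).1.1 (s (n + 1)).1.1 ≤ 6 * ε / 2 / 2 ^ n := fun n => by
    rw [dist_eq_norm]
    exact hF1 n (s n)
  have hs2 : ∀ n, dist (s n).1.2.1 (s (n + 1)).1.2.1 ≤ 6 * ε / 2 / 2 ^ n := fun n => by
    rw [dist_eq_norm]
    exact hF2 n (s n)
  obtain ⟨x, hx⟩ := cauchySeq_tendsto_of_complete (cauchySeq_of_le_geometric_two hs1)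
  obtain ⟨w, hw⟩ := cauchySeq_tendsto_of_complete (cauchySeq_of_le_geometric_two hs2)
  have hx0 := dist_le_of_le_geometric_two_of_tendsto₀ hs1 hx
  have hw0 := dist_le_of_le_geometric_two_of_tendsto₀ hs2 hw
  rw [dist_comm, dist_eq_norm] at hx0 hw0
  refine ⟨(x, w), hA.mem_gra fun b hb => ?_, hx0, hw0⟩
  have hlim : Tendsto (fun n => (b.2 - (s n).1.2.1) (b.1 - (s n).1.1) + (ε / 2 ^ n) ^ 2) atTop
      (𝓝 ((b.2 - w) (b.1 - x) + 0)) := by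
    have hc : Continuous fun q : StrongDual ℝ X × X => (b.2 - q.1) (b.1 - q.2) :=
      (continuous_const.sub continuous_fst).clm_apply (continuous_const.sub continuous_snd)
    refine ((hc.tendsto (w, x)).comp (hw.prodMk_nhds hx)).add ?_
    have : Tendsto (fun n : ℕ => ε * (1 / 2 : ℝ) ^ n) atTop (𝓝 (ε * 0)) :=
      (tendsto_pow_atTop_nhds_zero_of_lt_one (by norm_num) (by norm_num)).const_mul ε
    have := this.pow 2
    rw [mul_zero, zero_pow two_ne_zero] at this
    refine this.congr fun n => ?_
    rw [one_div, inv_pow, div_eq_mul_inv]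
  rw [add_zero] at hlim
  refine ge_of_tendsto' hlim fun n => ?_
  have h1 := hA.1.pairingHull_le hb (s n).2.1
  have h2 := (s n).2.2
  simp only [sub_apply, map_sub]
  linarith

end

/-! ### Helly's theorem and the implication (NI) ⟹ (D) -/

section

variable {X : Type*} [NormedAddCommGroup X] [NormedSpace ℝ X]

/-- **Helly's theorem** on solving finitely many linear equations in a ball. -/
theorem exists_norm_lt_forall_eq (x'' : StrongDual ℝ (StrongDual ℝ X)) {M : ℝ} (hM : ‖x''‖ < M)
    (F : Finset (StrongDual ℝ X)) : ∃ z : X, ‖z‖ < M ∧ ∀ f ∈ F, f z = x'' f := by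
  classical
  let T : X →ₗ[ℝ] (F → ℝ) := LinearMap.pi fun f => (f.1 : X →ₗ[ℝ] ℝ)
  obtain ⟨z₀, hz₀⟩ : (fun f : F => x'' f.1) ∈ LinearMap.range T := by
    by_contra hv
    obtain ⟨φ, hφ, hle⟩ := Submodule.exists_le_ker_of_notMem hv
    have hsum : ∀ v : F → ℝ, φ v = ∑ f, φ (Pi.single f 1) * v f := fun v => by
      conv_lhs => rw [LinearMap.pi_apply_eq_sum_univ φ v]
      exact Finset.sum_congr rfl fun f _ => by
        rw [smul_eq_mul, mul_comm]
        congr 2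
        ext g
        simp [Pi.single_apply, eq_comm]
    have h0 : ∑ f : F, φ (Pi.single f 1) • f.1 = 0 := by
      ext z
      have h1 : φ (T z) = 0 := hle ⟨z, rfl⟩
      rw [hsum] at h1
      simpa [T] using h1
    apply hφ
    have h2 := congrArg x'' h0
    rw [map_sum, map_zero] at h2
    rw [hsum, ← h2]
    exact Finset.sum_congr rfl fun f _ => by rw [map_smul, smul_eq_mul]
  have hz₀' : ∀ f : F, f.1 z₀ = x'' f.1 := fun f => congrFun hz₀ f
  let N : Submodule ℝ X := ⨅ f : F, LinearMap.ker (f.1 : X →ₗ[ℝ] ℝ)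
  obtain ⟨g, hg1, hg⟩ := exists_dual_vector'' ℝ (Submodule.Quotient.mk z₀ : X ⧸ N)
  -- A functional norming the class of z₀ vanishes on N, so it lies in the span of F. There x'' acts
  -- as evaluation at z₀, which bounds the quotient norm by ‖x''‖.
  let K : StrongDual ℝ X := g.comp N.mkQL
  have hK : ‖K‖ ≤ 1 := by
    refine K.opNorm_le_bound zero_le_one fun z => ?_
    exact (g.le_opNorm _).trans (mul_le_mul hg1 (Submodule.Quotient.norm_mk_le N z)
      (norm_nonneg _) zero_le_one)
  have hspan := mem_span_of_iInf_ker_le_ker (L := fun f : F => (f.1 : X →ₗ[ℝ] ℝ))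
    (K := (K : X →ₗ[ℝ] ℝ)) fun z hz => by
      have : (Submodule.Quotient.mk z : X ⧸ N) = 0 := (Submodule.Quotient.mk_eq_zero N).2 hz
      change g (Submodule.Quotient.mk z) = 0
      rw [this, map_zero]
  obtain ⟨c, hc⟩ := (Submodule.mem_span_range_iff_exists_fun ℝ).1 hspan
  have hKc : K = ∑ f : F, c f • f.1 := by
    ext z
    have := LinearMap.congr_fun hc z
    simpa using this.symm
  have hnorm : ‖(Submodule.Quotient.mk z₀ : X ⧸ N)‖ ≤ ‖x''‖ := by
    have h1 : x'' K = g (Submodule.Quotient.mk z₀) := by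
      have h2 : K z₀ = g (Submodule.Quotient.mk z₀) := rfl
      rw [← h2, hKc, map_sum]
      simp [hz₀']
    have h3 : x'' K = ‖(Submodule.Quotient.mk z₀ : X ⧸ N)‖ := by rw [h1, hg]; rfl
    rw [← h3]
    exact (le_abs_self _).trans ((x''.le_opNorm K).trans
      (mul_le_of_le_one_right (norm_nonneg _) hK))
  obtain ⟨m, hm, hmlt⟩ := Submodule.Quotient.norm_mk_lt (Submodule.Quotient.mk z₀ : X ⧸ N)
    (sub_pos.2 hM)
  refine ⟨m, by linarith, fun f hf => ?_⟩
  have hmem := (Submodule.Quotient.eq N).1 hm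
  have := (Submodule.mem_iInf _).1 hmem ⟨f, hf⟩
  rw [← hz₀' ⟨f, hf⟩]
  have h4 : f (m - z₀) = 0 := this
  rwa [map_sub, sub_eq_zero] at h4

theorem le_of_forall_pos_add_mul_le {a b c : ℝ} (h : ∀ μ > 0, a + μ * b ≤ c) : a ≤ c := by
  have hlim : Tendsto (fun μ : ℝ => a + μ * b) (𝓝[>] 0) (𝓝 (a + 0 * b)) :=
    ((continuous_const.add (continuous_id.mul continuous_const)).tendsto 0).mono_left
      nhdsWithin_le_nhds
  rw [zero_mul, add_zero] at hlim
  exact le_of_tendsto hlim (eventually_mem_nhdsWithin.mono h)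

/-- If the conjugate of the convex function generated by `C` majorizes the pairing with equality
at `(x', x'')`, then `(x'', x')` is a subgradient of this conjugate at `(x', x'')`. -/
theorem ConjMajorizesPairing.subgradient {C : Set (X × StrongDual ℝ X × ℝ)}
    (hNI : ConjMajorizesPairing C) {x' : StrongDual ℝ X} {x'' : StrongDual ℝ (StrongDual ℝ X)}
    (hx : ∀ p ∈ C, x' p.1 + x'' p.2.1 - p.2.2 ≤ x'' x') {y' : StrongDual ℝ X}
    {y'' : StrongDual ℝ (StrongDual ℝ X)} {s c : ℝ} (hs : 0 ≤ s)
    (hy : ∀ p ∈ C, y' p.1 + y'' p.2.1 - s * p.2.2 ≤ c) :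
    x'' y' + y'' x' - s * x'' x' ≤ c := by
  refine le_of_forall_pos_add_mul_le (b := y'' y' - s * c) fun μ hμ => ?_
  have hk : 0 < 1 + μ * s := by positivity
  -- Adding μ times `hy` to `hx` gives the last coordinate the coefficient 1 + μ * s; rescaling
  -- makes it 1 again. Dividing by μ and letting μ tend to 0 leaves the first-order term.
  have h1 := hNI ((1 + μ * s)⁻¹ • (x' + μ • y')) ((1 + μ * s)⁻¹ • (x'' + μ • y''))
    ((1 + μ * s)⁻¹ * (x'' x' + μ * c)) fun p hp => by
      have h2 := hx p hp
      have h3 := mul_le_mul_of_nonneg_left (hy p hp) hμ.le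
      have h4 : p.2.2 = (1 + μ * s)⁻¹ * ((1 + μ * s) * p.2.2) := (inv_mul_cancel_left₀ hk.ne' _).symm
      rw [h4]
      simp only [smul_apply, add_apply, smul_eq_mul]
      rw [← mul_add, ← mul_sub]
      exact mul_le_mul_of_nonneg_left (by linarith) (inv_pos.2 hk).le
  simp only [smul_apply, add_apply, smul_eq_mul, map_smul, map_add] at h1
  have h5 := (mul_le_mul_iff_right₀ (inv_pos.2 hk)).1 h1
  rw [mul_left_comm, ← mul_add, inv_mul_le_iff₀ hk] at h5
  refine le_of_mul_le_mul_left ?_ hμ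
  nlinarith

/-- Approximation by points of the hull that are bounded and close in the weak* topology. -/
theorem exists_mem_pairingHull_approx {A : X → Set (StrongDual ℝ X)}
    (hNI : IsTypeNI A) {x' : StrongDual ℝ X} {x'' : StrongDual ℝ (StrongDual ℝ X)}
    (hx : ∀ p ∈ gra A, x' p.1 + x'' p.2 - p.2 p.1 ≤ x'' x') {M : ℝ} (hM : ‖x''‖ < M)
    (F : Finset (StrongDual ℝ X)) {ε : ℝ} (hε : 0 < ε) :
    ∃ p ∈ pairingHull A, ‖p.1‖ < M ∧ (∀ f ∈ F, |f p.1 - x'' f| < ε) ∧ ‖p.2.1 - x'‖ < ε ∧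
      p.2.2 < x'' x' + ε := by
  classical
  by_contra! hcon
  let V : Set X := Metric.ball 0 M ∩ ⋂ f ∈ F, f ⁻¹' Metric.ball (x'' f) ε
  have hVconv : Convex ℝ V := (convex_ball 0 M).inter
    (convex_iInter₂ fun f _ => (convex_ball (x'' f) ε).is_linear_preimage f.isLinear)
  have hVo : IsOpen V := Metric.isOpen_ball.inter
    (isOpen_biInter_finset fun f _ => Metric.isOpen_ball.preimage f.continuous)
  have hV : ∀ z, ‖z‖ < M → (∀ f ∈ F, f z = x'' f) → z ∈ V := fun z hz hzF =>
    ⟨by simpa using hz, Set.mem_iInter₂.2 fun f hf => by simp [hzF f hf, hε]⟩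
  let O : Set (X × StrongDual ℝ X × ℝ) := V ×ˢ Metric.ball x' ε ×ˢ Set.Iio (x'' x' + ε)
  have hOmem : ∀ z ∈ V, (z, x', x'' x') ∈ O := fun z hz =>
    ⟨hz, Metric.mem_ball_self hε, by simp [hε]⟩
  obtain ⟨z₀, hz₀, hz₀F⟩ := exists_norm_lt_forall_eq x'' hM F
  obtain ⟨y', y'', s, c, hs, h1, h2⟩ := exists_separation (convex_pairingHull A)
    (hVconv.prod ((convex_ball x' ε).prod (convex_Iio _)))
    (hVo.prod (Metric.isOpen_ball.prod isOpen_Iio)) ⟨_, hOmem z₀ (hV z₀ hz₀ hz₀F)⟩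
    (fun p hp t ht => ⟨hp.1, hp.2.1, lt_of_le_of_lt ht hp.2.2⟩)
    (Set.disjoint_left.2 fun p hp hpC => by
      refine (hcon p hpC (by simpa using hp.1.1) (fun f hf => ?_)
        (by simpa [dist_eq_norm] using hp.2.1)).not_gt hp.2.2
      simpa [Real.dist_eq] using Set.mem_iInter₂.1 hp.1.2 f hf)
  -- Including y' lets z replace x'' in the separating functional, so separation contradicts the
  -- subgradient inequality.
  obtain ⟨z, hz, hzF⟩ := exists_norm_lt_forall_eq x'' hM (insert y' F)
  have h3 := h1 _ (hOmem z (hV z hz fun f hf => hzF f (Finset.mem_insert_of_mem hf)))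
  have h4 := hNI.conjMajorizesPairing.subgradient (x' := x') (x'' := x'')
    (fun p hp => by
      simpa using pairingHull_le (s := 1) (fun q hq => by simpa using hx q hq) p hp)
    (y' := -y') (y'' := -y'') (c := -c) hs fun p hp => by
      have := h2 p hp
      simp only [neg_apply]
      linarith
  have h5 := hzF y' (Finset.mem_insert_self _ _)
  simp only [neg_apply, map_neg] at h4
  dsimp only at h3
  linarith

theorem exists_mem_gra_approx [CompleteSpace X] {A : X → Set (StrongDual ℝ X)}
    (hA : IsMaximallyMonotone A) (hNI : IsTypeNI A) {x' : StrongDual ℝ X}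
    {x'' : StrongDual ℝ (StrongDual ℝ X)}
    (hx : ∀ p ∈ gra A, x' p.1 + x'' p.2 - p.2 p.1 ≤ x'' x')
    (F : Finset (StrongDual ℝ X)) {ε : ℝ} (hε : 0 < ε) (hε1 : ε ≤ 1) :
    ∃ p ∈ gra A, ‖p.1‖ ≤ ‖x''‖ + 2 ∧ (∀ f ∈ F, |f p.1 - x'' f| ≤ ε) ∧ ‖p.2 - x'‖ ≤ ε := by
  classical
  set R := ∑ f ∈ F, ‖f‖ with hR
  have hR0 : 0 ≤ R := Finset.sum_nonneg fun _ _ => norm_nonneg _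
  set η := ε / (12 * (R + 1)) with hη
  have hη0 : 0 < η := by positivity
  have hηε : 6 * η * (R + 1) = ε / 2 := by
    rw [hη]
    field_simp
    norm_num
  set M := ‖x''‖ + 1 with hM
  have hM1 : 1 ≤ M := by linarith [norm_nonneg x'']
  set κ := min (ε / 2) (η ^ 2 / (M + 3)) with hκ
  have hκ0 : 0 < κ := by positivity
  have hκ1 : κ ≤ ε / 2 := min_le_left _ _
  have hκ2 : κ * (M + 3) ≤ η ^ 2 := by
    rw [← le_div_iff₀ (by linarith)]
    exact min_le_right _ _
  -- Testing against x' as well makes the pairing at p close to x'' x', so the excess is below η².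
  -- The ensuing shift of at most 6η costs each f in F at most ε / 2.
  obtain ⟨p, hp, hp1, hpF, hp2, hp3⟩ := exists_mem_pairingHull_approx hNI hx
    (show ‖x''‖ < M by linarith) (insert x' F) hκ0
  have hgap : p.2.2 - p.2.1 p.1 < η ^ 2 := by
    have h1 := hpF x' (Finset.mem_insert_self _ _)
    have h2 := abs_pairing_le (p.2.1 - x') p.1
    have h3 : ‖p.2.1 - x'‖ * ‖p.1‖ ≤ κ * M :=
      mul_le_mul hp2.le hp1.le (norm_nonneg _) hκ0.le
    have h4 := neg_abs_le ((p.2.1 - x') p.1)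
    rw [sub_apply] at h2 h4
    have h5 := (abs_lt.1 h1).1
    nlinarith
  obtain ⟨q, hq, hq1, hq2⟩ := exists_mem_gra_near hA hNI hp hη0 hgap
  have h6η : 6 * η ≤ ε / 2 := by nlinarith
  refine ⟨q, hq, ?_, fun f hf => ?_, ?_⟩
  · have := norm_le_norm_add_norm_sub' q.1 p.1
    linarith
  · have h1 := hpF f (Finset.mem_insert_of_mem hf)
    have h2 := abs_pairing_le f (q.1 - p.1)
    have h3 : ‖f‖ ≤ R := Finset.single_le_sum (f := fun f => ‖f‖) (fun _ _ => norm_nonneg _) hf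
    have h4 : ‖f‖ * ‖q.1 - p.1‖ ≤ R * (6 * η) := mul_le_mul h3 hq1 (norm_nonneg _) hR0
    have h5 : |f q.1 - x'' f| ≤ |f (q.1 - p.1)| + |f p.1 - x'' f| := by
      rw [map_sub]
      exact abs_sub_le _ _ _
    nlinarith
  · have := norm_sub_le_norm_sub_add_norm_sub q.2 p.2.1 x'
    linarith

theorem IsTypeNI.isTypeD {X : Type*} [NormedAddCommGroup X] [NormedSpace ℝ X] [CompleteSpace X]
    {A : X → Set (StrongDual ℝ X)} (hA : IsMaximallyMonotone A) (hNI : IsTypeNI A) :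
    IsTypeD A := by
  classical
  intro x'' x' hinf
  have hx : ∀ p ∈ gra A, x' p.1 + x'' p.2 - p.2 p.1 ≤ x'' x' := fun p hp => by
    have := EReal.coe_nonneg.1 (le_iInf₂_iff.1 hinf p hp)
    simp only [sub_apply, map_sub, NormedSpace.dual_def] at this
    linarith
  choose q hq hq1 hq2 hq3 using fun i : Finset (StrongDual ℝ X) × ℕ =>
    exists_mem_gra_approx hA hNI hx i.1 (Nat.one_div_pos_of_nat (α := ℝ) (n := i.2))
      ((div_le_one (by positivity)).2 (by simp))
  have htend : Tendsto (fun i : Finset (StrongDual ℝ X) × ℕ => 1 / ((i.2 : ℝ) + 1)) atTop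
      (𝓝 0) := by
    rw [← prod_atTop_atTop_eq]
    exact tendsto_one_div_add_atTop_nhds_zero_nat.comp tendsto_snd
  refine ⟨Finset (StrongDual ℝ X) × ℕ, inferInstance, inferInstance, inferInstance,
    fun i => (q i).1, fun i => (q i).2, hq, ⟨max (‖x''‖ + 2) (‖x'‖ + 1), fun i => ⟨?_, ?_⟩⟩, ?_, ?_⟩
  · exact (hq1 i).trans (le_max_left _ _)
  · refine le_trans ?_ (le_max_right _ _)
    have h1 := norm_le_norm_add_norm_sub' (q i).2 x'
    have h2 : 1 / ((i.2 : ℝ) + 1) ≤ 1 := (div_le_one (by positivity)).2 (by simp)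
    linarith [hq3 i]
  · rw [tendsto_iff_forall_eval_tendsto_topDualPairing]
    intro f
    change Tendsto (fun i => f (q i).1) atTop (𝓝 (x'' f))
    rw [tendsto_iff_dist_tendsto_zero]
    refine squeeze_zero' (Eventually.of_forall fun _ => dist_nonneg) ?_ htend
    filter_upwards [eventually_ge_atTop (({f} : Finset (StrongDual ℝ X)), 0)] with i hi
    exact hq2 i f (hi.1 (Finset.mem_singleton_self f))
  · rw [tendsto_iff_norm_sub_tendsto_zero]
    exact squeeze_zero (fun _ => norm_nonneg _) hq3 htend

end

/-! ### Thickened segments and the implication (NI) ⟹ (FP) -/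

section

variable {X : Type*} [NormedAddCommGroup X] [NormedSpace ℝ X]

/-- The subdifferential at `0` of the sublinear function `max 0 v + ρ ‖·‖`. -/
theorem exists_eq_smul_add_of_le_max_add {v φ : StrongDual ℝ X} {ρ : ℝ} (hρ : 0 ≤ ρ)
    (h : ∀ z, φ z ≤ max 0 (v z) + ρ * ‖z‖) :
    ∃ l ∈ Set.Icc (0 : ℝ) 1, ∃ b : StrongDual ℝ X, ‖b‖ ≤ ρ ∧ φ = l • v + b := by
  -- Hahn–Banach extends φ from the diagonal of X × X under a bound that separates the two summands;
  -- the extension's restrictions to the factors split φ.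
  let D : X × X →ₗ.[ℝ] ℝ := ⟨LinearMap.range (LinearMap.prod LinearMap.id LinearMap.id),
    ((φ : X →ₗ[ℝ] ℝ).comp (LinearMap.fst ℝ X X)).domRestrict _⟩
  obtain ⟨g, hg, hgN⟩ := exists_extension_of_le_sublinear D
    (fun p => max 0 (v p.1) + ρ * ‖p.2‖)
    (fun c hc p => by
      have : max 0 (c * v p.1) = c * max 0 (v p.1) := by
        rw [mul_max_of_nonneg _ _ hc.le, mul_zero]
      simp only [Prod.smul_fst, Prod.smul_snd, map_smul, smul_eq_mul, norm_smul, this,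
        Real.norm_of_nonneg hc.le]
      ring)
    (fun p q => by
      have h1 : max 0 (v p.1 + v q.1) ≤ max 0 (v p.1) + max 0 (v q.1) :=
        max_le (add_nonneg (le_max_left _ _) (le_max_left _ _))
          (add_le_add (le_max_right _ _) (le_max_right _ _))
      have h2 := mul_le_mul_of_nonneg_left (norm_add_le p.2 q.2) hρ
      simp only [Prod.fst_add, Prod.snd_add, map_add]
      linarith)
    (by
      rintro ⟨_, z, rfl⟩
      exact h z)
  have hg2 : ∀ z, g (0, z) ≤ ρ * ‖z‖ := fun z => by simpa using hgN (0, z)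
  have hg1 : ∀ z, g (z, 0) ≤ max 0 (v z) := fun z => by simpa using hgN (z, 0)
  have hg1' : ∀ z, -g (z, 0) ≤ max 0 (-v z) := fun z => by
    have := hg1 (-z)
    rwa [map_neg, show ((-z, 0) : X × X) = -(z, 0) by simp, map_neg] at this
  have hsum : ∀ z, φ z = g (z, 0) + g (0, z) := fun z => by
    rw [← map_add, Prod.mk_add_mk, add_zero, zero_add]
    exact (hg ⟨(z, z), z, rfl⟩).symm
  let b : StrongDual ℝ X := (g.comp (LinearMap.inr ℝ X X)).mkContinuous ρ fun z => by
    rw [Real.norm_eq_abs]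
    refine abs_le'.2 ⟨hg2 z, ?_⟩
    have := hg2 (-z)
    rwa [norm_neg, show ((0, -z) : X × X) = -(0, z) by simp, map_neg] at this
  have hb : ∀ z, b z = g (0, z) := fun z => rfl
  have hbn : ‖b‖ ≤ ρ := LinearMap.mkContinuous_norm_le _ hρ _
  by_cases hv : ∃ z, v z ≠ 0
  · obtain ⟨z, hz⟩ := hv
    set u := (v z)⁻¹ • z with hu
    have hvu : v u = 1 := by rw [hu, map_smul, smul_eq_mul, inv_mul_cancel₀ hz]
    refine ⟨g (u, 0), ⟨?_, ?_⟩, b, hbn, ?_⟩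
    · have := hg1' u
      rw [hvu] at this
      norm_num at this
      exact this
    · have := hg1 u
      rw [hvu] at this
      norm_num at this
      exact this
    · ext y
      -- The first restriction is bounded by max 0 v, so it vanishes on the kernel of v and is a
      -- multiple of v.
      have h1 : v (y - v y • u) = 0 := by rw [map_sub, map_smul, hvu]; simp
      have h2 := hg1 (y - v y • u)
      have h3 := hg1' (y - v y • u)
      rw [h1] at h2 h3
      have h4 : ((y - v y • u, 0) : X × X) = (y, 0) - v y • (u, 0) := by simp
      rw [h4, map_sub, map_smul, smul_eq_mul] at h2 h3
      norm_num at h2 h3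
      rw [hsum, add_apply, smul_apply, smul_eq_mul, hb]
      linarith
  · push Not at hv
    refine ⟨0, by simp, b, hbn, ?_⟩
    ext y
    have h2 := hg1 y
    have h3 := hg1' y
    rw [hv] at h2 h3
    norm_num at h2 h3
    rw [hsum, add_apply, smul_apply, smul_eq_mul, hb]
    linarith

/-- The function `z ↦ sup {-⟨z, w⟩ - ‖w‖² / 2 | w ∈ W}`. -/
noncomputable def negConj (W : Set (StrongDual ℝ X)) (z : X) : ℝ :=
  ⨆ w : W, (-(w.1 z) - ‖w.1‖ ^ 2 / 2)

theorem neg_sub_half_sq_le (w : StrongDual ℝ X) (z : X) :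
    -(w z) - ‖w‖ ^ 2 / 2 ≤ ‖z‖ ^ 2 / 2 := by
  have h1 := abs_pairing_le w z
  have h2 := neg_abs_le (w z)
  have h3 := sq_nonneg (‖w‖ - ‖z‖)
  nlinarith

theorem le_negConj {W : Set (StrongDual ℝ X)} {w : StrongDual ℝ X} (hw : w ∈ W) (z : X) :
    -(w z) - ‖w‖ ^ 2 / 2 ≤ negConj W z :=
  le_ciSup (f := fun w : W => -(w.1 z) - ‖w.1‖ ^ 2 / 2)
    ⟨‖z‖ ^ 2 / 2, by rintro _ ⟨w, rfl⟩; exact neg_sub_half_sq_le _ _⟩ ⟨w, hw⟩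

theorem negConj_le {W : Set (StrongDual ℝ X)} (hW : W.Nonempty) {z : X} {c : ℝ}
    (h : ∀ w ∈ W, -(w z) - ‖w‖ ^ 2 / 2 ≤ c) : negConj W z ≤ c :=
  haveI := hW.to_subtype
  ciSup_le fun w => h w.1 w.2

theorem convexOn_negConj {W : Set (StrongDual ℝ X)} (hW : W.Nonempty) :
    ConvexOn ℝ Set.univ (negConj W) := by
  refine ⟨convex_univ, fun x _ y _ a b ha hb hab => negConj_le hW fun w hw => ?_⟩
  have h1 := mul_le_mul_of_nonneg_left (le_negConj hw x) ha
  have h2 := mul_le_mul_of_nonneg_left (le_negConj hw y) hb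
  have h3 : ‖w‖ ^ 2 / 2 = a * (‖w‖ ^ 2 / 2) + b * (‖w‖ ^ 2 / 2) := by
    rw [← add_mul, hab, one_mul]
  simp only [map_add, map_smul, smul_eq_mul]
  linarith

theorem continuous_negConj {W : Set (StrongDual ℝ X)} (hW : W.Nonempty) {R : ℝ} (hR : 0 ≤ R)
    (hWR : ∀ w ∈ W, ‖w‖ ≤ R) : Continuous (negConj W) := by
  refine (LipschitzWith.of_le_add_mul ⟨R, hR⟩ fun x y => negConj_le hW fun w hw => ?_).continuous
  have h1 := le_negConj hw y
  have h2 := abs_pairing_le w (x - y)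
  have h3 := neg_abs_le (w (x - y))
  have h4 := mul_le_mul_of_nonneg_right (hWR w hw) (norm_nonneg (x - y))
  rw [map_sub] at h2 h3
  rw [dist_eq_norm]
  change _ ≤ negConj W y + R * ‖x - y‖
  linarith

theorem mem_thickening_segment_iff {v w : StrongDual ℝ X} {ρ : ℝ} :
    w ∈ Metric.thickening ρ (segment ℝ 0 v) ↔ ∃ l ∈ Set.Icc (0 : ℝ) 1, ‖w - l • v‖ < ρ := by
  rw [Metric.mem_thickening_iff, segment_eq_image']
  simp [dist_eq_norm]

theorem zero_mem_thickening_segment {v : StrongDual ℝ X} {ρ : ℝ} (hρ : 0 < ρ) :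
    (0 : StrongDual ℝ X) ∈ Metric.thickening ρ (segment ℝ 0 v) :=
  Metric.self_subset_thickening hρ _ (left_mem_segment ℝ _ _)

/-- The bound drops the quadratic term and is positively homogeneous, so it can be tested along rays
to constrain y' in the conjugate estimate below. -/
theorem negConj_thickening_segment_le {v : StrongDual ℝ X} {ρ : ℝ} (hρ : 0 < ρ) (z : X) :
    negConj (Metric.thickening ρ (segment ℝ 0 v)) z ≤ max 0 (-(v z)) + ρ * ‖z‖ := by
  refine negConj_le ⟨0, zero_mem_thickening_segment hρ⟩ fun w hw => ?_
  obtain ⟨l, ⟨hl0, hl1⟩, hl⟩ := mem_thickening_segment_iff.1 hw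
  have h1 := abs_pairing_le (w - l • v) z
  have h2 := neg_abs_le ((w - l • v) z)
  have h3 := mul_le_mul_of_nonneg_right hl.le (norm_nonneg z)
  have h4 : l * -(v z) ≤ max 0 (-(v z)) :=
    (mul_le_mul_of_nonneg_left (le_max_right 0 (-(v z))) hl0).trans
      (mul_le_of_le_one_left (le_max_left _ _) hl1)
  have h5 := sq_nonneg ‖w‖
  simp only [sub_apply, smul_apply, smul_eq_mul] at h1 h2
  linarith

/-- Large multiples of z show that -y' lies in the segment plus the closed ρ-ball. If -y' itself
were in the open thickening, w = -y' would finish as for half squared norms; its multiples by θ < 1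
are, and θ → 1. -/
theorem neg_pairing_le_of_negConj_le {v : StrongDual ℝ X} {ρ : ℝ} (hρ : 0 < ρ)
    (y' : StrongDual ℝ X) (y'' : StrongDual ℝ (StrongDual ℝ X)) (c : ℝ)
    (h : ∀ z, ∀ w ∈ Metric.thickening ρ (segment ℝ 0 v),
      y' z + y'' w - negConj (Metric.thickening ρ (segment ℝ 0 v)) z - ‖w‖ ^ 2 / 2 ≤ c) :
    -y'' y' ≤ c := by
  have hle : ∀ z, y' z ≤ max 0 (-(v z)) + ρ * ‖z‖ := by
    intro z
    by_contra! hlt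
    set d := y' z - (max 0 (-(v z)) + ρ * ‖z‖) with hd
    have hd0 : 0 < d := sub_pos.2 hlt
    set k := (|c| + 1) / d with hk
    have hk0 : 0 < k := by positivity
    have h1 := h (k • z) 0 (zero_mem_thickening_segment hρ)
    have h2 := negConj_thickening_segment_le (v := v) hρ (k • z)
    have h3 : max 0 (-(k * v z)) = k * max 0 (-(v z)) := by
      rw [mul_max_of_nonneg _ _ hk0.le, mul_zero, mul_neg]
    rw [map_smul, norm_smul, Real.norm_of_nonneg hk0.le, smul_eq_mul, h3] at h2
    rw [map_smul, smul_eq_mul, map_zero, norm_zero] at h1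
    have h4 : k * d = |c| + 1 := div_mul_cancel₀ _ hd0.ne'
    have h5 : k * d = k * y' z - (k * max 0 (-(v z)) + ρ * (k * ‖z‖)) := by
      rw [hd]
      ring
    linarith [le_abs_self c]
  obtain ⟨l, ⟨hl0, hl1⟩, b, hb, hy⟩ := exists_eq_smul_add_of_le_max_add (v := v) (φ := -y') hρ.le
    fun z => by simpa using hle (-z)
  have key : ∀ θ ∈ Set.Ioo (0 : ℝ) 1, θ * -y'' y' ≤ c := by
    rintro θ ⟨hθ0, hθ1⟩
    have hmem : θ • -y' ∈ Metric.thickening ρ (segment ℝ 0 v) := by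
      refine mem_thickening_segment_iff.2
        ⟨θ * l, ⟨by positivity, mul_le_one₀ hθ1.le hl0 hl1⟩, ?_⟩
      rw [hy, smul_add, mul_smul, add_sub_cancel_left, norm_smul, Real.norm_of_nonneg hθ0.le]
      nlinarith [norm_nonneg b]
    have h1 : ‖y'‖ ^ 2 / 2 ≤ c + θ * y'' y' + θ ^ 2 * ‖y'‖ ^ 2 / 2 := half_sq_norm_le fun z => by
      have h2 := h z _ hmem
      have h3 := negConj_le (z := z) ⟨0, zero_mem_thickening_segment (v := v) hρ⟩
        fun w _ => neg_sub_half_sq_le w z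
      rw [norm_smul, norm_neg, Real.norm_of_nonneg hθ0.le, map_smul, map_neg, smul_eq_mul,
        mul_pow] at h2
      linarith
    nlinarith [mul_nonneg (sub_nonneg.2 hθ1.le) (sq_nonneg ‖y'‖),
      mul_nonneg (mul_nonneg hθ0.le (sub_nonneg.2 hθ1.le)) (sq_nonneg ‖y'‖)]
  have hlim : Tendsto (fun θ : ℝ => θ * -y'' y') (𝓝[<] 1) (𝓝 (1 * -y'' y')) :=
    ((continuous_id.mul continuous_const).tendsto 1).mono_left nhdsWithin_le_nhds
  rw [one_mul] at hlim
  refine le_of_tendsto hlim ?_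
  filter_upwards [Ioo_mem_nhdsLT (zero_lt_one' ℝ)] with θ hθ using key θ hθ

/-- Coercivity of `negConj` on sets that contain a ball. -/
theorem mul_norm_sub_le_negConj {W : Set (StrongDual ℝ X)} {s : ℝ} (hs : 0 ≤ s)
    (hW : ∀ w : StrongDual ℝ X, ‖w‖ ≤ s → w ∈ W) (z : X) :
    s * ‖z‖ - s ^ 2 / 2 ≤ negConj W z := by
  obtain ⟨g, hg1, hg⟩ := exists_dual_vector'' ℝ z
  have hn : ‖(-s) • g‖ ≤ s := by
    rw [norm_smul, norm_neg, Real.norm_of_nonneg hs]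
    exact mul_le_of_le_one_right hs hg1
  have h1 := le_negConj (hW _ hn) z
  have h2 : ((-s) • g) z = -(s * ‖z‖) := by
    rw [smul_apply, hg, smul_eq_mul, neg_mul]
    rfl
  rw [h2] at h1
  have h3 := pow_le_pow_left₀ (norm_nonneg _) hn 2
  linarith

/-- If `(x₀, w₀)` is monotonically related to the part of `gra A` with second component near the
segment from `w₀` to a point of the range, then `gra A` has points arbitrarily close to it. -/
theorem exists_mem_gra_near_of_related [CompleteSpace X] {A : X → Set (StrongDual ℝ X)}
    (hA : IsMaximallyMonotone A) (hNI : IsTypeNI A) {x₀ : X} {w₀ : StrongDual ℝ X}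
    {e : X × StrongDual ℝ X} (he : e ∈ gra A) {ρ : ℝ}
    (hrel : ∀ q ∈ gra A, q.2 - w₀ ∈ Metric.thickening (2 * ρ) (segment ℝ 0 (e.2 - w₀)) →
      0 ≤ (q.2 - w₀) (q.1 - x₀)) {s : ℝ} (hs : 0 < s) (hsρ : s < ρ) :
    ∃ q ∈ gra A, ‖q.1 - x₀‖ ≤ 3 * s ∧ ‖q.2 - w₀‖ ≤ 3 * s := by
  have hρ : 0 < ρ := hs.trans hsρ
  set W := Metric.thickening ρ (segment ℝ 0 (e.2 - w₀)) with hW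
  have hW0 : (0 : StrongDual ℝ X) ∈ W := zero_mem_thickening_segment hρ
  have hWR : ∀ w ∈ W, ‖w‖ ≤ ρ + ‖e.2 - w₀‖ := by
    intro w hw
    obtain ⟨l, ⟨hl0, hl1⟩, hl⟩ := mem_thickening_segment_iff.1 hw
    have h1 := norm_le_norm_sub_add w (l • (e.2 - w₀))
    rw [norm_smul, Real.norm_of_nonneg hl0] at h1
    nlinarith [norm_nonneg (e.2 - w₀)]
  have hWball : ∀ w : StrongDual ℝ X, ‖w‖ ≤ s → w ∈ W := fun w hw =>
    mem_thickening_segment_iff.2 ⟨0, by simp, by simpa using hw.trans_lt hsρ⟩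
  -- Small enough that the errors 6ε from passing to the graph are absorbed, both in the estimate
  -- for a and b and in the final 2s + 6ε ≤ 3s.
  set ε := s / 100 with hε
  have hε0 : 0 < ε := by positivity
  obtain ⟨p, hp, hpW, hlt⟩ := exists_add_lt_of_conjMajorizesPairing_center
    (convex_pairingHull A) hNI.conjMajorizesPairing Metric.isOpen_thickening
    (convexOn_negConj ⟨0, hW0⟩) (continuous_negConj ⟨0, hW0⟩ (by positivity) hWR)
    (convexOn_half_sq_norm.subset (Set.subset_univ W) ((convex_segment _ _).thickening ρ))
    continuous_half_sq_norm x₀ w₀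
    ⟨_, mem_pairingHull he, Metric.self_subset_thickening hρ _ (right_mem_segment ℝ _ _)⟩
    (neg_pairing_le_of_negConj_le hρ) (pow_pos hε0 2)
  have hf1 := le_negConj hpW (p.1 - x₀)
  have hf2 := mul_norm_sub_le_negConj hs.le hWball (p.1 - x₀)
  have hgap : p.2.2 - p.2.1 p.1 < ε ^ 2 := by
    simp only [sub_apply, map_sub] at hf1
    linarith
  obtain ⟨q, hq, hq1, hq2⟩ := exists_mem_gra_near hA hNI hp hε0 hgap
  -- The doubled radius in `hrel` leaves room for the shift from p to q, since 6ε < ρ.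
  have hqrel := hrel q hq (by
    obtain ⟨l, hl, hlt⟩ := mem_thickening_segment_iff.1 hpW
    refine mem_thickening_segment_iff.2 ⟨l, hl, ?_⟩
    have h1 := norm_add_le (q.2 - p.2.1) (p.2.1 - w₀ - l • (e.2 - w₀))
    rw [show q.2 - p.2.1 + (p.2.1 - w₀ - l • (e.2 - w₀)) = q.2 - w₀ - l • (e.2 - w₀) by abel] at h1
    linarith)
  have hpair := hA.pairing_le_of_mem_pairingHull hp
  set a := ‖p.1 - x₀‖ with ha
  set b := ‖p.2.1 - w₀‖ with hb
  have ha0 : 0 ≤ a := norm_nonneg _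
  have hb0 : 0 ≤ b := norm_nonneg _
  have hexp : (q.2 - w₀) (q.1 - x₀) = (p.2.1 - w₀) (p.1 - x₀) + (q.2 - p.2.1) (p.1 - x₀) +
      (p.2.1 - w₀) (q.1 - p.1) + (q.2 - p.2.1) (q.1 - p.1) := by
    simp only [sub_apply, map_sub]
    ring
  have h1 : (q.2 - p.2.1) (p.1 - x₀) ≤ 6 * ε * a :=
    ((le_abs_self _).trans (abs_pairing_le _ _)).trans (mul_le_mul_of_nonneg_right hq2 ha0)
  have h2 : (p.2.1 - w₀) (q.1 - p.1) ≤ b * (6 * ε) :=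
    ((le_abs_self _).trans (abs_pairing_le _ _)).trans (mul_le_mul_of_nonneg_left hq1 hb0)
  have h3 : (q.2 - p.2.1) (q.1 - p.1) ≤ 6 * ε * (6 * ε) :=
    ((le_abs_self _).trans (abs_pairing_le _ _)).trans
      (mul_le_mul hq2 hq1 (norm_nonneg _) (by positivity))
  have h4 : (p.2.1 - w₀) (p.1 - x₀) = p.2.1 p.1 - w₀ p.1 - p.2.1 x₀ + w₀ x₀ := by
    simp only [sub_apply, map_sub]
    ring
  -- The relation at q bounds the pairing at p from below up to errors of order ε; the coercive
  -- terms s * a and b² / 2 then bound both distances.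
  have hmain : (s - 6 * ε) * a + (b ^ 2 / 2 - 6 * ε * b) < s ^ 2 / 2 + 37 * ε ^ 2 := by
    linarith
  have hs' : s = 100 * ε := by rw [hε]; ring
  have hasmall : a ≤ 2 * s := by
    rw [hs'] at hmain ⊢
    nlinarith [sq_nonneg (b - 6 * ε)]
  have hbsmall : b ≤ 2 * s := by
    rw [hs'] at hmain ⊢
    by_contra! hb'
    nlinarith [mul_nonneg hε0.le ha0]
  refine ⟨q, hq, ?_, ?_⟩
  · have := norm_sub_le_norm_sub_add_norm_sub q.1 p.1 x₀
    linarith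
  · have := norm_sub_le_norm_sub_add_norm_sub q.2 p.2.1 w₀
    linarith

theorem IsTypeNI.isTypeFP [CompleteSpace X] {A : X → Set (StrongDual ℝ X)}
    (hA : IsMaximallyMonotone A) (hNI : IsTypeNI A) : IsTypeFP A := by
  rintro U hU hUc ⟨e', heU, he⟩ x₀ w₀ hw₀ hrel
  obtain ⟨e, he⟩ := Set.mem_iUnion.1 he
  have hcompact : IsCompact (segment ℝ w₀ e') := by
    rw [segment_eq_image']
    exact isCompact_Icc.image (by fun_prop)
  obtain ⟨r, hr, hrU⟩ := hcompact.exists_thickening_subset_open hU (hUc.segment_subset hw₀ heU)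
  have hmemU : ∀ w, w - w₀ ∈ Metric.thickening (2 * (r / 2)) (segment ℝ 0 (e' - w₀)) → w ∈ U := by
    intro w hw
    obtain ⟨l, hl, hlt⟩ := mem_thickening_segment_iff.1 hw
    refine hrU (Metric.mem_thickening_iff.2 ⟨w₀ + l • (e' - w₀), ?_, ?_⟩)
    · rw [segment_eq_image']
      exact ⟨l, hl, rfl⟩
    · rw [dist_eq_norm, ← sub_sub]
      linarith
  have hnear := fun s hs hs' => exists_mem_gra_near_of_related hA hNI (x₀ := x₀) (w₀ := w₀)
    (e := (e, e')) he (ρ := r / 2) (fun q hq hqW => hrel q (Or.inr ⟨hq, trivial, hmemU _ hqW⟩)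
      (x₀, w₀) (Or.inl rfl)) (s := s) hs hs'
  rw [← hA.isClosed_gra.closure_eq, Metric.mem_closure_iff]
  intro η hη
  obtain ⟨q, hq, hq1, hq2⟩ := hnear (min (r / 4) (η / 4)) (by positivity)
    ((min_le_left _ _).trans_lt (by linarith))
  have hmin := min_le_right (r / 4) (η / 4)
  refine ⟨q, hq, ?_⟩
  rw [dist_comm, Prod.dist_eq, dist_eq_norm, dist_eq_norm]
  exact max_lt (by dsimp only; linarith) (by dsimp only; linarith)

end

end MonotoneOperator

theorem corollary3p2 {X : Type*} [NormedAddCommGroup X] [NormedSpace ℝ X] [CompleteSpace X]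
    (A : X → Set (StrongDual ℝ X)) (hA : MonotoneOperator.IsMaximallyMonotone A) :
    [MonotoneOperator.IsTypeD A, MonotoneOperator.IsTypeNI A,
      MonotoneOperator.IsTypeFP A].TFAE := by
  tfae_have 1 → 2 := fun h => h.isTypeNI
  tfae_have 2 → 1 := fun h => h.isTypeD hA
  tfae_have 2 → 3 := fun h => h.isTypeFP hA
  tfae_have 3 → 2 := fun h => h.isTypeNI hA
  tfae_finish
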